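/- Let $\Phi:\mathbb R\to[0,\infty)$ be a Young function (convex, even, $\Phi(0)=0$, $\Phi(x)\to+\infty$ as $x\to+\infty$) which is $C^2$ on $(0,\infty)$ and satisfies $\Phi(x)=x\varphi(x)$ for $x\ge 0$, where $\varphi:[0,\infty)\to\mathbb R$ is non-decreasing and concave, $\varphi(0)>0$ and $\lim_{x\to+\infty}\varphi(x)=+\infty$. Let $k_0>0$ be the unique positive solution of $k_0\Phi'(k_0)=1$. Assume that there are constants $\gamma\in\mathbb R$ and $\kappa\ge 0$ such that for all $x,y>0$ $$x\varphi'(x)\le\gamma\qquad\text{and}\qquad \varphi(xy)\le\kappa+\varphi(x)+\varphi(y),$$ and a constant $\lambda\ge 2$ such that $\lambda\,\varphi(x/\varphi(x))\ge\varphi(x)$ for every $x\ge 2\lambda$. Let $\mu$ be a Borel probability measure on $\mathbb R^n$ satisfying the Poincaré inequality with a constant $C_P\in[0,\infty)$, that is, $\int f^2d\mu-\left(\int f\,d\mu\right)^2\le C_P\int|\nabla f|^2d\mu$ for every $C^\infty$ function $f:\mathbb R^n\to\mathbb R$ with $\int f^2d\mu<\infty$. Let $C_\Phi\in[0,\infty]$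 be the optimal (smallest) constant such that for every $C^\infty$ function $f:\mathbb R^n\to\mathbb R$ with $\int f^2d\mu<\infty$ $$\int\Phi(f^2)\,d\mu-\Phi\left(\int f^2d\mu\right)\le C_\Phi\int|\nabla f|^2d\mu .$$ For a Borel set $A\subset\mathbb R^n$ with $\mu(A)<\tfrac12$ let $$\mathrm{Cap}_\mu(A)=\inf\left\{\int|\nabla f|^2d\mu\;:\; f\in C^\infty(\mathbb R^n),\ \mathbf 1_A\le f\le 1,\ \mu(f=0)\ge\tfrac12\right\}\in[0,\infty],$$ and let $\widetilde B(\Phi)\in[0,\infty]$ be the smallest constant such that for every Borel set $A\subset\mathbb R^n$ with $\mu(A)<\tfrac12$ $$\mu(A)\,\varphi\left(\frac{2}{\mu(A)}\right)\le\widetilde B(\Phi)\,\mathrm{Cap}_\mu(A),$$ where the left-hand side is $0$ if $\mu(A)=0$. (Both optimal constants are understood as the infimum of the admissible constants in $[0,\infty]$, with $0\cdot\infty=0$.) Then for every $a>0$ $$\frac{k_0\,a\,\Phi''(a)\,\varphi(0)}{8\lambda\left(\varphi(0)+2a\Phi''(a)\right)}\;\widetilde B(\Phi)\;\le\; C_\Phi\;\le\;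 18\gamma C_P+24\left(1+\frac{\kappa}{\varphi(8)}\right)\widetilde B(\Phi).$$ -/

import Mathlib

open Set Filter MeasureTheory ProbabilityTheory
open scoped ENNReal ContDiff

namespace PhiSobolev

/-- `ℝⁿ` with its Euclidean norm. -/
abbrev E (n : ℕ) : Type := EuclideanSpace ℝ (Fin n)

/-- A finite-valued Young function on `ℝ`: nonnegative, convex, even, zero at zero, and tending to
`+∞` at `+∞`. -/
structure IsYoung (Φ : ℝ → ℝ) : Prop where
  nonneg : ∀ x, 0 ≤ Φ x
  convex : ConvexOn ℝ univ Φ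
  even : ∀ x, Φ (-x) = Φ x
  zero : Φ 0 = 0
  tendsto : Tendsto Φ atTop atTop

/-- The energy `∫ |∇ f|² dμ`, with values in `[0, ∞]`. -/
noncomputable def energy {n : ℕ} (μ : Measure (E n)) (f : E n → ℝ) : ℝ≥0∞ :=
  ∫⁻ x, ‖gradient f x‖ₑ ^ 2 ∂μ

/-- Poincaré inequality with constant `C`: `Var_μ f ≤ C ∫ |∇ f|² dμ` for all smooth
square-integrable `f`. -/
def Poincare {n : ℕ} (μ : Measure (E n)) (C : ℝ≥0∞) : Prop :=
  ∀ f : E n → ℝ, ContDiff ℝ ∞ f → MemLp f 2 μ → evariance f μ ≤ C * energy μ f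

/-- Additive `Φ`-Sobolev inequality with constant `C`:
`∫ Φ(f²) dμ - Φ(∫ f² dμ) ≤ C ∫ |∇ f|² dμ` for all smooth square-integrable `f`. The term
`Φ(∫ f² dμ)`, which is finite, stands on the right, so that `∫ Φ(f²) dμ` may be infinite. -/
def AdditiveSobolev {n : ℕ} (μ : Measure (E n)) (Φ : ℝ → ℝ) (C : ℝ≥0∞) : Prop :=
  ∀ f : E n → ℝ, ContDiff ℝ ∞ f → MemLp f 2 μ →
    ∫⁻ x, ENNReal.ofReal (Φ (f x ^ 2)) ∂μ
      ≤ ENNReal.ofReal (Φ (∫ x, f x ^ 2 ∂μ)) + C * energy μ f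

/-- The optimal constant in the additive `Φ`-Sobolev inequality (`∞` if no finite constant is
admissible). -/
noncomputable def sobolevConst {n : ℕ} (μ : Measure (E n)) (Φ : ℝ → ℝ) : ℝ≥0∞ :=
  sInf {C : ℝ≥0∞ | AdditiveSobolev μ Φ C}

/-- The capacity `Cap_μ(A)`: the infimum of `∫ |∇ f|² dμ` over smooth `f` with `1_A ≤ f ≤ 1` and
`μ(f = 0) ≥ 1/2` (`∞` if there is no such `f`). -/
noncomputable def capacity {n : ℕ} (μ : Measure (E n)) (A : Set (E n)) : ℝ≥0∞ :=
  sInf (energy μ '' {f : E n → ℝ | ContDiff ℝ ∞ f ∧ (∀ x, A.indicator 1 x ≤ f x) ∧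
    (∀ x, f x ≤ 1) ∧ 1 / 2 ≤ μ {x | f x = 0}})

/-- The smallest `B` with `μ(A) φ(2 / μ(A)) ≤ B * Cap_μ(A)` for all Borel sets `A` with
`μ(A) < 1/2` (`∞` if no finite constant is admissible); the left side is `0` when `μ(A) = 0`. -/
noncomputable def capacityConst {n : ℕ} (μ : Measure (E n)) (φ : ℝ → ℝ) : ℝ≥0∞ :=
  sInf {B : ℝ≥0∞ | ∀ A : Set (E n), MeasurableSet A → μ A < 1 / 2 →
    ENNReal.ofReal (μ.real A * φ (2 / μ.real A)) ≤ B * capacity μ A}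

end PhiSobolev

namespace PhiSobolev

/-! Upper bound: put `m = ∫ f²` and split at `f² = 4m`. Below that level the tangent line of the
concave `φ` at `m` bounds `Φ(f²)` by `f² φ(m)`, a term of zero mean, and `φ'(m)(f² - m)²`. Since
`|f| ≤ 2√m` there, the last is at most `9 m φ'(m) (|f| - √m)²`, whose integral is at most `18 γ Var
f`; Poincaré finishes this part. Above the level, `φ(f²) ≤ κ + φ(m) + φ(f²/m)`, and the excess over
`f² φ(m)` is summed over dyadic layers of `f²`. Each layer is controlled by the capacity of a
superlevel set, with a cutoff of `f` as test function; its gradient lives on the layer just below,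
and these layers are disjoint, so the energies add up to at most that of `f`
(`setLIntegral_tail_le`).

Lower bound: testing the Sobolev inequality near the constant `√a` gives a Poincaré inequality
(`variance_le_of_additiveSobolev`), so an admissible capacity function `f`, vanishing on half the
mass, has `∫ f²` bounded by its energy. Testing with `√s f` and choosing `s` inversely proportional
to the energy gives `Φ(s) μ(A) ≤ 1`. The `λ`-condition turns this into a bound on `μ(A) φ(2/μ(A))`
(`mul_le_of_mul_self_le`). -/

/-! ### Smooth cutoffs with sharp slope -/

/-- A one-sided smooth step rising from `0` to `1` inside `[0.7072, 1]`, of slope at most `√12`. -/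
theorem exists_smooth_step : ∃ h : ℝ → ℝ, ContDiff ℝ ∞ h ∧ (∀ s, 0 ≤ h s) ∧ (∀ s, h s ≤ 1) ∧
    (∀ s, s ≤ 0.7072 → h s = 0) ∧ (∀ s, 1 ≤ s → h s = 1) ∧ (∀ s, deriv h s ^ 2 ≤ 12) ∧
    ∀ s, s ≤ 0.7072 ∨ 1 ≤ s → deriv h s = 0 := by
  -- The step is the primitive of a normalized bump supported on `[0.7072, 1]`, with `0.7072` just
  -- above `1/√2`. The bump is almost a plateau: its density is at most `1/0.2888 < 3.4627 < √12`,
  -- close to the least possible slope `1/(1 - 1/√2) ≈ 3.414`.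
  let b : ContDiffBump (0.8536 : ℝ) := ⟨0.1444, 0.1464, by norm_num, by norm_num⟩
  set g : ℝ → ℝ := b.normed volume with hg
  have hgs : ContDiff ℝ ∞ g := b.contDiff_normed
  have hgc : Continuous g := hgs.continuous
  have hg0 : ∀ s, 0 ≤ g s := fun s => b.nonneg_normed s
  have hsupp : Function.support g = Ioo 0.7072 1 := by
    rw [hg, b.support_normed_eq, Real.ball_eq_Ioo]
    norm_num [b]
  have hz : ∀ s, s ≤ 0.7072 ∨ 1 ≤ s → g s = 0 := by
    intro s hs
    by_contra hne
    have : s ∈ Function.support g := hne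
    rw [hsupp] at this
    rcases hs with hs | hs
    · exact absurd this.1 (not_lt.2 hs)
    · exact absurd this.2 (not_lt.2 hs)
  have hint : Integrable g := b.integrable_normed
  have hd : ∀ s, deriv (fun u => ∫ x in (0.7072 : ℝ)..u, g x) s = g s :=
    fun s => hgc.deriv_integral g _ s
  have h1 : ∀ s, 1 ≤ s → ∫ x in (0.7072 : ℝ)..s, g x = 1 := by
    intro s hs
    rw [intervalIntegral.integral_eq_integral_of_support_subset, hg, b.integral_normed]
    rw [hsupp]
    exact fun x hx => ⟨hx.1, hx.2.le.trans hs⟩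
  have h0 : ∀ s, s ≤ 0.7072 → ∫ x in (0.7072 : ℝ)..s, g x = 0 := by
    intro s hs
    rw [intervalIntegral.integral_congr (g := fun _ => 0)]
    · simp
    · intro x hx
      rw [uIcc_of_ge hs] at hx
      exact hz x (Or.inl hx.2)
  have hmono : Monotone (fun u => ∫ x in (0.7072 : ℝ)..u, g x) := by
    refine monotone_of_deriv_nonneg (fun s => ?_) (fun s => by rw [hd]; exact hg0 s)
    exact (intervalIntegral.integral_hasDerivAt_right (hgc.intervalIntegrable _ _)
      (hgc.stronglyMeasurableAtFilter _ _) hgc.continuousAt).differentiableAt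
  refine ⟨fun u => ∫ x in (0.7072 : ℝ)..u, g x, ?_, ?_, ?_, h0, h1, ?_, ?_⟩
  · rw [contDiff_infty_iff_deriv]
    refine ⟨fun s => (intervalIntegral.integral_hasDerivAt_right (hgc.intervalIntegrable _ _)
      (hgc.stronglyMeasurableAtFilter _ _) hgc.continuousAt).differentiableAt, ?_⟩
    rw [show deriv (fun u => ∫ x in (0.7072 : ℝ)..u, g x) = g from funext hd]
    exact hgs
  · intro s
    have := hmono (min_le_left s 0.7072)
    simp only [h0 _ (min_le_right s 0.7072)] at this
    exact this
  · intro s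
    have := hmono (le_max_left s 1)
    simp only [h1 _ (le_max_right s 1)] at this
    exact this
  · intro s
    rw [hd]
    have hb := b.normed_le_div_measure_closedBall_rIn volume s
    have hv : (volume : Measure ℝ).real (Metric.closedBall 0.8536 b.rIn) = 0.2888 := by
      rw [measureReal_def, Real.volume_closedBall, ENNReal.toReal_ofReal] <;> norm_num [b]
    rw [hv] at hb
    have h2 : g s ≤ 3.4627 := hb.trans (by norm_num)
    nlinarith [hg0 s]
  · intro s hs
    rw [hd]
    exact hz s hs

/-- An even smooth cutoff: `0` for `s² ≤ t²/2`, `1` for `t² ≤ s²`, with `|H'|² ≤ 12 / t²`. -/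
theorem exists_even_cutoff {t : ℝ} (ht : 0 < t) : ∃ H : ℝ → ℝ, ContDiff ℝ ∞ H ∧ (∀ s, 0 ≤ H s) ∧
    (∀ s, H s ≤ 1) ∧ (∀ s, s ^ 2 ≤ t ^ 2 / 2 → H s = 0) ∧ (∀ s, t ^ 2 ≤ s ^ 2 → H s = 1) ∧
    (∀ s, deriv H s ^ 2 ≤ 12 / t ^ 2) ∧
    ∀ s, s ^ 2 ≤ t ^ 2 / 2 ∨ t ^ 2 ≤ s ^ 2 → deriv H s = 0 := by
  obtain ⟨h, hs, h0, h1, hlo, hhi, hd, hd0⟩ := exists_smooth_step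
  have hdiff : Differentiable ℝ h := hs.differentiable (by simp)
  have hder : ∀ s, HasDerivAt (fun s => h (s / t) + h (-s / t))
      (deriv h (s / t) * (1 / t) + deriv h (-s / t) * (-1 / t)) s := by
    intro s
    have e1 : HasDerivAt (fun s : ℝ => s / t) (1 / t) s := (hasDerivAt_id s).div_const t
    have e2 : HasDerivAt (fun s : ℝ => -s / t) (-1 / t) s := (hasDerivAt_neg s).div_const t
    exact ((hdiff _).hasDerivAt.comp s e1).add ((hdiff _).hasDerivAt.comp s e2)
  have hneg : ∀ s, s ≤ 0 → s / t ≤ 0.7072 := fun s hs =>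
    (div_nonpos_of_nonpos_of_nonneg hs ht.le).trans (by norm_num)
  have hsmall : ∀ s, s ^ 2 ≤ t ^ 2 / 2 → s / t ≤ 0.7072 := by
    intro s hs
    rw [div_le_iff₀ ht]
    exact abs_le_of_sq_le_sq' (by nlinarith) (by positivity) |>.2
  have hlarge : ∀ s, 0 ≤ s → t ^ 2 ≤ s ^ 2 → 1 ≤ s / t := by
    intro s hs0 hs
    rw [le_div_iff₀ ht, one_mul]
    exact abs_le_of_sq_le_sq' hs hs0 |>.2
  have hone : ∀ s, h (s / t) = 0 ∨ h (-s / t) = 0 := by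
    intro s
    rcases le_total s 0 with h' | h'
    · exact Or.inl (hlo _ (hneg _ h'))
    · exact Or.inr (hlo _ (hneg _ (by linarith)))
  refine ⟨fun s => h (s / t) + h (-s / t), ?_, ?_, ?_, ?_, ?_, ?_, ?_⟩
  · exact (hs.comp (contDiff_id.div_const t)).add (hs.comp (contDiff_neg.div_const t))
  · exact fun s => add_nonneg (h0 _) (h0 _)
  · intro s
    rcases hone s with h' | h'
    · simpa [h'] using h1 (-s / t)
    · simpa [h'] using h1 (s / t)
  · intro s hs
    simp [hlo _ (hsmall s hs), hlo _ (hsmall (-s) (by simpa using hs))]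
  · intro s hs
    rcases le_total s 0 with h' | h'
    · simp [hlo _ (hneg _ h'), hhi _ (hlarge (-s) (by linarith) (by simpa using hs))]
    · simp [hlo _ (hneg (-s) (by linarith)), hhi _ (hlarge s h' hs)]
  · intro s
    rw [(hder s).deriv, le_div_iff₀ (by positivity)]
    have key : ∀ r : ℝ, (r * (1 / t)) ^ 2 * t ^ 2 = r ^ 2 := by intro r; field_simp
    have key' : ∀ r : ℝ, (r * (-1 / t)) ^ 2 * t ^ 2 = r ^ 2 := by intro r; field_simp
    rcases le_total s 0 with h' | h'
    · rw [hd0 _ (Or.inl (hneg _ h')), zero_mul, zero_add, key']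
      exact hd _
    · rw [hd0 (-s / t) (Or.inl (hneg _ (by linarith))), zero_mul, add_zero, key]
      exact hd _
  · intro s hs
    rw [(hder s).deriv]
    have : deriv h (s / t) = 0 ∧ deriv h (-s / t) = 0 := by
      rcases hs with hs | hs
      · exact ⟨hd0 _ (Or.inl (hsmall s hs)), hd0 _ (Or.inl (hsmall (-s) (by simpa using hs)))⟩
      · rcases le_total s 0 with h' | h'
        · exact ⟨hd0 _ (Or.inl (hneg _ h')),
            hd0 _ (Or.inr (hlarge (-s) (by linarith) (by simpa using hs)))⟩
        · exact ⟨hd0 _ (Or.inr (hlarge s h' hs)), hd0 _ (Or.inl (hneg _ (by linarith)))⟩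
    simp [this.1, this.2]

/-! ### Energies of compositions and capacity of superlevel sets -/

theorem enorm_gradient_comp {n : ℕ} {f : E n → ℝ} {h : ℝ → ℝ} {h' : ℝ} {x : E n}
    (hh : HasDerivAt h h' (f x)) (hf : DifferentiableAt ℝ f x) :
    ‖gradient (fun y => h (f y)) x‖ₑ = ‖h'‖ₑ * ‖gradient f x‖ₑ := by
  have e : fderiv ℝ (fun y => h (f y)) x = h' • fderiv ℝ f x :=
    (hh.comp_hasFDerivAt x hf.hasFDerivAt).fderiv
  unfold gradient
  rw [e, map_smul, enorm_smul]

theorem enorm_sq_eq_ofReal (r : ℝ) : ‖r‖ₑ ^ 2 = ENNReal.ofReal (r ^ 2) := by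
  rw [Real.enorm_eq_ofReal_abs, ← ENNReal.ofReal_pow (abs_nonneg r), sq_abs]

theorem energy_const_mul {n : ℕ} (μ : Measure (E n)) {f : E n → ℝ} (hf : Differentiable ℝ f)
    (c : ℝ) : energy μ (fun x => c * f x) = ENNReal.ofReal (c ^ 2) * energy μ f := by
  unfold energy
  rw [← lintegral_const_mul' _ _ ENNReal.ofReal_ne_top]
  refine lintegral_congr fun x => ?_
  have : HasDerivAt (fun s : ℝ => c * s) c (f x) := by
    simpa using (hasDerivAt_id (f x)).const_mul c
  rw [enorm_gradient_comp this (hf x), mul_pow, enorm_sq_eq_ofReal]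

/-- Capacity of a superlevel set of `f²`, estimated by the energy of `f` on a layer. -/
theorem capacity_superlevel_le {n : ℕ} (μ : Measure (E n)) {f : E n → ℝ} (hf : ContDiff ℝ ∞ f)
    {r : ℝ} (hr : 0 < r) (hμ : 1 / 2 ≤ μ {x | f x ^ 2 ≤ r / 2}) :
    capacity μ {x | r < f x ^ 2} ≤ ENNReal.ofReal (12 / r) *
      ∫⁻ x in {x | r / 2 < f x ^ 2 ∧ f x ^ 2 < r}, ‖gradient f x‖ₑ ^ 2 ∂μ := by
  obtain ⟨H, hs, h0, h1, hlo, hhi, hd, hd0⟩ := exists_even_cutoff (Real.sqrt_pos.2 hr)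
  rw [Real.sq_sqrt hr.le] at hlo hhi hd hd0
  have hmem : (fun x => H (f x)) ∈ {g : E n → ℝ | ContDiff ℝ ∞ g ∧
      (∀ x, {x | r < f x ^ 2}.indicator 1 x ≤ g x) ∧ (∀ x, g x ≤ 1) ∧
      1 / 2 ≤ μ {x | g x = 0}} := by
    refine ⟨hs.comp hf, fun x => ?_, fun x => h1 _, hμ.trans (measure_mono fun x hx => hlo _ hx)⟩
    by_cases hx : r < f x ^ 2
    · rw [indicator_of_mem (by exact hx)]; exact (hhi _ hx.le).ge
    · rw [indicator_of_notMem (by exact hx)]; exact h0 _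
  refine (sInf_le (mem_image_of_mem _ hmem)).trans ?_
  have hms : MeasurableSet {x | r / 2 < f x ^ 2 ∧ f x ^ 2 < r} :=
    (measurableSet_lt measurable_const (hf.continuous.measurable.pow_const 2)).inter
      (measurableSet_lt (hf.continuous.measurable.pow_const 2) measurable_const)
  unfold energy
  rw [← lintegral_indicator hms, ← lintegral_const_mul' _ _ ENNReal.ofReal_ne_top]
  refine lintegral_mono fun x => ?_
  rw [enorm_gradient_comp (hs.differentiable (by simp) _).hasDerivAt
    (hf.differentiable (by simp) x), mul_pow, enorm_sq_eq_ofReal]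
  by_cases hx : x ∈ {x | r / 2 < f x ^ 2 ∧ f x ^ 2 < r}
  · rw [indicator_of_mem hx]
    gcongr
    exact hd _
  · have : f x ^ 2 ≤ r / 2 ∨ r ≤ f x ^ 2 := by
      by_contra hc
      push Not at hc
      exact hx hc
    simp [hd0 _ this]

/-! ### The tail `f² > 4m` by dyadic layers -/

theorem measureReal_sq_gt_le {n : ℕ} (μ : Measure (E n)) [IsProbabilityMeasure μ] {f : E n → ℝ}
    (hL : MemLp f 2 μ) {c : ℝ} (hc : 0 < c) (hm : 0 < ∫ x, f x ^ 2 ∂μ) :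
    μ.real {x | c * ∫ x, f x ^ 2 ∂μ < f x ^ 2} ≤ 1 / c := by
  have h := mul_meas_ge_le_integral_of_nonneg (μ := μ) (f := fun x => f x ^ 2)
    (Eventually.of_forall fun x => sq_nonneg _) hL.integrable_sq (c * ∫ x, f x ^ 2 ∂μ)
  have h2 : μ.real {x | c * ∫ x, f x ^ 2 ∂μ < f x ^ 2}
      ≤ μ.real {x | c * ∫ x, f x ^ 2 ∂μ ≤ f x ^ 2} :=
    measureReal_mono (ofPred_subset_ofPred.2 fun x hx => hx.le)
  rw [le_div_iff₀ hc]
  refine (mul_le_mul_of_nonneg_right h2 hc.le).trans ?_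
  refine le_of_mul_le_mul_right ?_ hm
  linarith

/-- Markov gives `μ(A) ≤ 1/c` for `A = {f² > cm}`, hence `φ(2c) ≤ φ(2/μ(A))`, so the capacity
inequality for `A` controls the integrand frozen at its largest value on the layer. The factor `24`
is `2cm · 12/(cm)`. -/
theorem setLIntegral_layer_le {n : ℕ} (μ : Measure (E n)) [IsProbabilityMeasure μ] {φ : ℝ → ℝ}
    (hmono : MonotoneOn φ (Ici 0)) (hφ0 : 0 < φ 0) {κ : ℝ} (hκ : 0 ≤ κ) {B : ℝ≥0∞}
    (hB : ∀ A : Set (E n), MeasurableSet A → μ A < 1 / 2 →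
      ENNReal.ofReal (μ.real A * φ (2 / μ.real A)) ≤ B * capacity μ A)
    {f : E n → ℝ} (hf : ContDiff ℝ ∞ f) (hL : MemLp f 2 μ) {m : ℝ} (hm : 0 < m)
    (hmf : ∫ x, f x ^ 2 ∂μ = m) {c : ℝ} (hc : 4 ≤ c) :
    ∫⁻ x in {x | c * m < f x ^ 2 ∧ f x ^ 2 ≤ 2 * c * m},
        ENNReal.ofReal (f x ^ 2 * (κ + φ (f x ^ 2 / m))) ∂μ
      ≤ ENNReal.ofReal (24 * (1 + κ / φ 8)) * B *
        ∫⁻ x in {x | c * m / 2 < f x ^ 2 ∧ f x ^ 2 < c * m}, ‖gradient f x‖ₑ ^ 2 ∂μ := by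
  have hc0 : 0 < c := by linarith
  have hfm : Measurable fun x => f x ^ 2 := hf.continuous.measurable.pow_const 2
  have hφpos : ∀ x, 0 ≤ x → 0 < φ x := fun x hx => hφ0.trans_le (hmono self_mem_Ici hx hx)
  set A : Set (E n) := {x | c * m < f x ^ 2} with hA
  have hAm : MeasurableSet A := measurableSet_lt measurable_const hfm
  set T : Set (E n) := {x | c * m < f x ^ 2 ∧ f x ^ 2 ≤ 2 * c * m} with hT
  set D := ∫⁻ x in {x | c * m / 2 < f x ^ 2 ∧ f x ^ 2 < c * m}, ‖gradient f x‖ₑ ^ 2 ∂μ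
  have hMle : μ.real A ≤ 1 / c := by
    have := measureReal_sq_gt_le μ hL hc0 (hmf ▸ hm)
    rwa [hmf] at this
  have hM4 : μ.real A ≤ 1 / 4 := hMle.trans (one_div_le_one_div_of_le (by norm_num) hc)
  have hAlt : μ A < 1 / 2 := by
    rw [← ofReal_measureReal (measure_ne_top μ A)]
    refine (ENNReal.ofReal_le_ofReal hM4).trans_lt ?_
    rw [show (1 / 2 : ℝ≥0∞) = ENNReal.ofReal (1 / 2) by
      rw [ENNReal.ofReal_div_of_pos (by norm_num)]; simp]
    exact (ENNReal.ofReal_lt_ofReal_iff (by norm_num)).2 (by norm_num)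
  -- Markov at level `c/2`: the exceptional mass is at most `2/c ≤ 1/2`. This is what requires `4 ≤
  -- c`, hence the splitting level `4m`.
  have hhalf : 1 / 2 ≤ μ {x | f x ^ 2 ≤ c * m / 2} := by
    have h1 := measureReal_sq_gt_le μ hL (c := c / 2) (by linarith) (hmf ▸ hm)
    rw [hmf] at h1
    have h2 : {x | f x ^ 2 ≤ c * m / 2} = {x | c / 2 * m < f x ^ 2}ᶜ := by
      ext x; simp only [mem_ofPred_eq, mem_compl_iff, not_lt]; rw [div_mul_eq_mul_div]
    have h3 : (1 / 2 : ℝ) ≤ μ.real {x | f x ^ 2 ≤ c * m / 2} := by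
      rw [h2, probReal_compl_eq_one_sub (measurableSet_lt measurable_const hfm)]
      have : 1 / (c / 2) ≤ 1 / 2 := one_div_le_one_div_of_le (by norm_num) (by linarith)
      linarith
    rw [← ofReal_measureReal (measure_ne_top μ {x | f x ^ 2 ≤ c * m / 2})]
    refine le_trans (le_of_eq ?_) (ENNReal.ofReal_le_ofReal h3)
    rw [ENNReal.ofReal_div_of_pos (by norm_num)]; simp
  have hcap : capacity μ A ≤ ENNReal.ofReal (12 / (c * m)) * D :=
    capacity_superlevel_le μ hf (by positivity) hhalf
  have h8 : 0 < φ 8 := hφpos 8 (by norm_num)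
  have hlevel : (κ + φ (2 * c)) * μ.real A ≤
      (1 + κ / φ 8) * (μ.real A * φ (2 / μ.real A)) := by
    rcases (measureReal_nonneg (μ := μ) (s := A)).eq_or_lt with h0 | h0
    · simp [← h0]
    -- The `8` is the least value of `2c`; here the additive `κ` is absorbed into a multiple of
    -- `φ(2c)`.
    have e1 : κ ≤ κ / φ 8 * φ (2 * c) := by
      rw [div_mul_eq_mul_div, le_div_iff₀ h8]
      exact mul_le_mul_of_nonneg_left
        (hmono (by norm_num : (8 : ℝ) ∈ Ici 0) (by simp; linarith) (by linarith)) hκ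
    have e2 : φ (2 * c) ≤ φ (2 / μ.real A) := by
      refine hmono (by simp; linarith) (by simp only [mem_Ici]; positivity) ?_
      rw [le_div_iff₀ h0]
      rw [le_div_iff₀ hc0] at hMle
      linarith
    have e3 : 0 ≤ 1 + κ / φ 8 := by positivity
    calc (κ + φ (2 * c)) * μ.real A ≤ ((1 + κ / φ 8) * φ (2 * c)) * μ.real A := by
          gcongr; linarith
      _ ≤ ((1 + κ / φ 8) * φ (2 / μ.real A)) * μ.real A := by gcongr
      _ = _ := by ring
  calc ∫⁻ x in T, ENNReal.ofReal (f x ^ 2 * (κ + φ (f x ^ 2 / m))) ∂μ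
      ≤ ∫⁻ x in T, ENNReal.ofReal (2 * c * m * (κ + φ (2 * c))) ∂μ := by
        refine setLIntegral_mono measurable_const fun x hx => ENNReal.ofReal_le_ofReal ?_
        have hq : f x ^ 2 / m ≤ 2 * c := by rw [div_le_iff₀ hm]; exact hx.2
        have hq0 : 0 ≤ f x ^ 2 / m := by positivity
        have := hφpos _ hq0
        exact mul_le_mul hx.2 (by linarith [hmono hq0 (hq0.trans hq) hq]) (by linarith)
          (by positivity)
    _ = ENNReal.ofReal (2 * c * m * (κ + φ (2 * c))) * μ T := setLIntegral_const _ _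
    _ ≤ ENNReal.ofReal (2 * c * m * (κ + φ (2 * c))) * μ A := by
        gcongr; exact fun x hx => hx.1
    _ = ENNReal.ofReal (2 * c * m) * ENNReal.ofReal ((κ + φ (2 * c)) * μ.real A) := by
        rw [← ofReal_measureReal (measure_ne_top μ A), ← ENNReal.ofReal_mul',
          ← ENNReal.ofReal_mul (by positivity), mul_assoc]
        exact measureReal_nonneg
    _ ≤ ENNReal.ofReal (2 * c * m) * (ENNReal.ofReal (1 + κ / φ 8) *
          (B * (ENNReal.ofReal (12 / (c * m)) * D))) := by
        gcongr
        refine (ENNReal.ofReal_le_ofReal hlevel).trans ?_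
        rw [ENNReal.ofReal_mul (by positivity)]
        gcongr
        exact (hB A hAm hAlt).trans (by gcongr)
    _ = ENNReal.ofReal (2 * c * m) * ENNReal.ofReal (12 / (c * m)) *
          ENNReal.ofReal (1 + κ / φ 8) * B * D := by ring
    _ = _ := by
        rw [← ENNReal.ofReal_mul (by positivity), ← ENNReal.ofReal_mul (by positivity)]
        congr 4
        field_simp
        norm_num

theorem exists_dyadic_layer {c y : ℝ} (hc : 0 < c) (hy : c < y) :
    ∃ k : ℕ, 2 ^ k * c < y ∧ y ≤ 2 ^ (k + 1) * c := by
  have hex : ∃ k : ℕ, y ≤ 2 ^ k * c := by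
    obtain ⟨k, hk⟩ := pow_unbounded_of_one_lt (y / c) (one_lt_two (α := ℝ))
    exact ⟨k, (div_le_iff₀ hc).1 hk.le⟩
  classical
  rcases h : Nat.find hex with _ | k
  · have := Nat.find_spec hex
    rw [h] at this
    simp at this
    linarith
  · refine ⟨k, not_le.1 (Nat.find_min hex (by omega)), ?_⟩
    have := Nat.find_spec hex
    rwa [h] at this

theorem setLIntegral_tail_le {n : ℕ} (μ : Measure (E n)) [IsProbabilityMeasure μ] {φ : ℝ → ℝ}
    (hmono : MonotoneOn φ (Ici 0)) (hφ0 : 0 < φ 0) {κ : ℝ} (hκ : 0 ≤ κ) {B : ℝ≥0∞}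
    (hB : ∀ A : Set (E n), MeasurableSet A → μ A < 1 / 2 →
      ENNReal.ofReal (μ.real A * φ (2 / μ.real A)) ≤ B * capacity μ A)
    {f : E n → ℝ} (hf : ContDiff ℝ ∞ f) (hL : MemLp f 2 μ) {m : ℝ} (hm : 0 < m)
    (hmf : ∫ x, f x ^ 2 ∂μ = m) :
    ∫⁻ x in {x | 4 * m < f x ^ 2}, ENNReal.ofReal (f x ^ 2 * (κ + φ (f x ^ 2 / m))) ∂μ
      ≤ ENNReal.ofReal (24 * (1 + κ / φ 8)) * B * energy μ f := by
  have hfm : Measurable fun x => f x ^ 2 := hf.continuous.measurable.pow_const 2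
  set c : ℕ → ℝ := fun k => 2 ^ k * 4 with hcdef
  have hc4 : ∀ k, 4 ≤ c k := fun k => by
    have : (1 : ℝ) ≤ 2 ^ k := one_le_pow₀ (by norm_num)
    simp only [hcdef]; linarith
  set T : ℕ → Set (E n) := fun k => {x | c k * m < f x ^ 2 ∧ f x ^ 2 ≤ 2 * c k * m}
  set D : ℕ → Set (E n) := fun k => {x | c k * m / 2 < f x ^ 2 ∧ f x ^ 2 < c k * m}
  have hsub : {x | 4 * m < f x ^ 2} ⊆ ⋃ k, T k := by
    intro x hx
    obtain ⟨k, h1, h2⟩ := exists_dyadic_layer (by positivity : 0 < 4 * m) hx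
    refine mem_iUnion.2 ⟨k, ?_, ?_⟩
    · simpa only [hcdef, mul_assoc] using h1
    · refine h2.trans (le_of_eq ?_)
      simp only [hcdef]; ring
  have hDm : ∀ k, MeasurableSet (D k) := fun k =>
    (measurableSet_lt measurable_const hfm).inter (measurableSet_lt hfm measurable_const)
  -- Since `c` doubles at each step, the lower end `c (k+1) m / 2` of a gradient layer is the upper
  -- end `c k m` of the preceding one.
  have hdisj : Pairwise (Function.onFun Disjoint D) := by
    refine (pairwise_disjoint_on D).2 fun i j hij => ?_
    refine disjoint_left.2 fun x hi hj => ?_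
    have h1 : (2 : ℝ) ^ (i + 1) ≤ 2 ^ j := pow_le_pow_right₀ (by norm_num) hij
    have h2 : c i * m ≤ c j * m / 2 := by
      simp only [hcdef]
      rw [pow_succ] at h1
      nlinarith
    exact absurd hj.1 (not_lt.2 (hi.2.le.trans h2))
  calc ∫⁻ x in {x | 4 * m < f x ^ 2}, ENNReal.ofReal (f x ^ 2 * (κ + φ (f x ^ 2 / m))) ∂μ
      ≤ ∫⁻ x in ⋃ k, T k, ENNReal.ofReal (f x ^ 2 * (κ + φ (f x ^ 2 / m))) ∂μ :=
        lintegral_mono_set hsub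
    _ ≤ ∑' k, ∫⁻ x in T k, ENNReal.ofReal (f x ^ 2 * (κ + φ (f x ^ 2 / m))) ∂μ :=
        lintegral_iUnion_le _ _
    _ ≤ ∑' k, ENNReal.ofReal (24 * (1 + κ / φ 8)) * B * ∫⁻ x in D k, ‖gradient f x‖ₑ ^ 2 ∂μ :=
        ENNReal.tsum_le_tsum fun k =>
          setLIntegral_layer_le μ hmono hφ0 hκ hB hf hL hm hmf (hc4 k)
    _ = ENNReal.ofReal (24 * (1 + κ / φ 8)) * B * ∫⁻ x in ⋃ k, D k, ‖gradient f x‖ₑ ^ 2 ∂μ := by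
        rw [ENNReal.tsum_mul_left, lintegral_iUnion hDm hdisj]
    _ ≤ _ := by
        gcongr
        exact setLIntegral_le_lintegral _ _

/-! ### The bulk `f² ≤ 4m` and the upper bound -/

/-- A concave function lies below its tangent lines. -/
theorem le_tangent_of_concaveOn {φ : ℝ → ℝ} (hconc : ConcaveOn ℝ (Ici 0) φ) {m x : ℝ}
    (hm : 0 < m) (hx : 0 ≤ x) (hd : DifferentiableAt ℝ φ m) :
    φ x ≤ φ m + deriv φ m * (x - m) := by
  rcases lt_trichotomy x m with h | h | h
  · have := hconc.deriv_le_slope hx hm.le h hd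
    rw [slope_def_field, le_div_iff₀ (by linarith)] at this
    linarith
  · simp [h]
  · have := hconc.slope_le_deriv hm.le hx h hd
    rw [slope_def_field, div_le_iff₀ (by linarith)] at this
    linarith

/-- With `a = ∫ |f|`, the left side is `2m - 2√m a`. Since `|∫ f| ≤ a ≤ √m`, it is at most `2(m -
a²) ≤ 2(m - (∫ f)²)`. -/
theorem integral_abs_sub_sqrt_sq_le {n : ℕ} (μ : Measure (E n)) [IsProbabilityMeasure μ]
    {f : E n → ℝ} (hL : MemLp f 2 μ) {m : ℝ} (hm : 0 ≤ m) (hmf : ∫ x, f x ^ 2 ∂μ = m) :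
    ∫ x, (|f x| - √m) ^ 2 ∂μ ≤ 2 * variance f μ := by
  have hi1 : Integrable f μ := hL.integrable (by norm_num)
  have hi2 := hL.integrable_sq
  have hv := variance_eq_sub hL
  have hv' := variance_eq_sub hL.abs
  have hnn := variance_nonneg (fun x => |f x|) μ
  simp only [Pi.pow_apply] at hv hv'
  rw [hmf] at hv
  change Var[fun x => |f x|; μ] = _ at hv'
  rw [hv'] at hnn
  simp only [Pi.abs_apply, sq_abs] at hnn
  rw [hmf] at hnn
  set a := ∫ x, |f x| ∂μ with ha
  have ha0 : 0 ≤ a := integral_nonneg fun x => abs_nonneg _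
  have hfa : (∫ x, f x ∂μ) ^ 2 ≤ a ^ 2 := by
    rw [← sq_abs (∫ x, f x ∂μ)]
    gcongr
    exact abs_integral_le_integral_abs
  have e : ∫ x, (|f x| - √m) ^ 2 ∂μ = 2 * m - 2 * √m * a := by
    have : ∀ x, (|f x| - √m) ^ 2 = f x ^ 2 - 2 * √m * |f x| + m := by
      intro x
      rw [sub_sq, sq_abs, Real.sq_sqrt hm]; ring
    simp_rw [this]
    have j1 : Integrable (fun x => 2 * √m * |f x|) μ := hi1.abs.const_mul _
    have j2 : Integrable (fun x => f x ^ 2 - 2 * √m * |f x|) μ := hi2.sub j1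
    rw [integral_add j2 (integrable_const _), integral_sub hi2 j1, integral_const_mul, hmf]
    simp
    ring
  have hs : a ≤ √m := Real.le_sqrt_of_sq_le (by linarith)
  rw [e, hv]
  nlinarith [Real.sq_sqrt hm]

/-- Here the bulk and tail estimates combine, for any admissible capacity constant `B`, through one
integrable majorant `G` of the bulk that also supplies `f² φ(m)` on the tail. -/
theorem additiveSobolev_of_capacity {n : ℕ} (μ : Measure (E n)) [IsProbabilityMeasure μ]
    {Φ φ : ℝ → ℝ} (hnn : ∀ x, 0 ≤ Φ x) (hΦφ : ∀ x, 0 ≤ x → Φ x = x * φ x)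
    (hmono : MonotoneOn φ (Ici 0)) (hconc : ConcaveOn ℝ (Ici 0) φ)
    (hφd : ∀ x, 0 < x → DifferentiableAt ℝ φ x)
    (hφ0 : 0 < φ 0) {γ κ : ℝ} (hκ : 0 ≤ κ) (hγ : ∀ x, 0 < x → x * deriv φ x ≤ γ)
    (hsub : ∀ x y, 0 < x → 0 < y → φ (x * y) ≤ κ + φ x + φ y)
    {CP : ℝ} (hP : Poincare μ (ENNReal.ofReal CP)) {B : ℝ≥0∞}
    (hB : ∀ A : Set (E n), MeasurableSet A → μ A < 1 / 2 →
      ENNReal.ofReal (μ.real A * φ (2 / μ.real A)) ≤ B * capacity μ A) :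
    AdditiveSobolev μ Φ
      (ENNReal.ofReal (18 * γ * CP) + ENNReal.ofReal (24 * (1 + κ / φ 8)) * B) := by
  intro f hf hL
  have hi2 := hL.integrable_sq
  have hfm : Measurable fun x => f x ^ 2 := hf.continuous.measurable.pow_const 2
  obtain ⟨m, hmf⟩ : ∃ m, ∫ x, f x ^ 2 ∂μ = m := ⟨_, rfl⟩
  have hm0 : 0 ≤ m := hmf ▸ integral_nonneg fun x => sq_nonneg _
  rcases hm0.eq_or_lt with hm | hm
  · have h0 : (fun x => f x ^ 2) =ᵐ[μ] 0 :=
      (integral_eq_zero_iff_of_nonneg (fun x => sq_nonneg _) hi2).1 (hmf.trans hm.symm)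
    have : ∫⁻ x, ENNReal.ofReal (Φ (f x ^ 2)) ∂μ = ∫⁻ _, 0 ∂μ := by
      refine lintegral_congr_ae ?_
      filter_upwards [h0] with x hx
      simp only [Pi.zero_apply] at hx
      rw [hx, hΦφ 0 le_rfl]; simp
    rw [this]; simp
  have hφpos : ∀ x, 0 ≤ x → 0 < φ x := fun x hx => hφ0.trans_le (hmono self_mem_Ici hx hx)
  set d := deriv φ m with hd
  have hd0 : 0 ≤ d := by
    have h := le_tangent_of_concaveOn hconc hm (by linarith : 0 ≤ m + 1) (hφd m hm)
    have h2 := hmono (show m ∈ Ici (0 : ℝ) from hm.le) (show m + 1 ∈ Ici (0 : ℝ) by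
      simp only [mem_Ici]; linarith) (by linarith)
    rw [← hd] at h
    linarith
  set c := m * d with hc
  have hc0 : 0 ≤ c := by positivity
  have hcγ : c ≤ γ := hγ m hm
  -- The tangent bound rests on `f²(f² - m) = (f² - m)² + m(f² - m)`. The last summand of `G`
  -- integrates to zero, and the first to `Φ m`.
  set G : E n → ℝ := fun x => f x ^ 2 * φ m + 9 * c * (|f x| - √m) ^ 2 + c * (f x ^ 2 - m) with hG
  have hsq : √m ^ 2 = m := Real.sq_sqrt hm.le
  have hsmall : ∀ x, f x ^ 2 ≤ 4 * m → Φ (f x ^ 2) ≤ G x := by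
    intro x hx
    rw [hΦφ _ (sq_nonneg _)]
    have ht := le_tangent_of_concaveOn hconc hm (sq_nonneg (f x)) (hφd m hm)
    rw [← hd] at ht
    have h1 := mul_le_mul_of_nonneg_left ht (sq_nonneg (f x))
    have hab : |f x| ≤ 2 * √m := by
      refine abs_le_of_sq_le_sq ?_ (by positivity)
      rw [mul_pow, hsq]; linarith
    have h2 : (f x ^ 2 - m) ^ 2 ≤ 9 * m * (|f x| - √m) ^ 2 := by
      have e : (f x ^ 2 - m) ^ 2 = (|f x| + √m) ^ 2 * (|f x| - √m) ^ 2 := by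
        rw [← mul_pow, ← sq_sub_sq, sq_abs, hsq]
      rw [e]
      gcongr
      have : |f x| + √m ≤ 3 * √m := by linarith
      calc (|f x| + √m) ^ 2 ≤ (3 * √m) ^ 2 := by gcongr
        _ = 9 * m := by rw [mul_pow, hsq]; norm_num
    have h3 := mul_le_mul_of_nonneg_left h2 hd0
    simp only [hG, hc]
    nlinarith
  have hG0 : ∀ x, f x ^ 2 * φ m ≤ G x ∨ f x ^ 2 ≤ 4 * m := by
    intro x
    rcases le_or_gt (f x ^ 2) (4 * m) with h | h
    · exact Or.inr h
    · left
      have : 0 ≤ c * (f x ^ 2 - m) := mul_nonneg hc0 (by linarith)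
      have : 0 ≤ 9 * c * (|f x| - √m) ^ 2 := by positivity
      simp only [hG]; linarith
  -- Nonnegativity, not obvious from the formula because of the centred term, allows `∫⁻ G` to be
  -- computed as a Bochner integral.
  have hGnn : ∀ x, 0 ≤ G x := by
    intro x
    rcases hG0 x with h | h
    · exact (mul_nonneg (sq_nonneg _) (hφpos m hm.le).le).trans h
    · exact (hnn _).trans (hsmall x h)
  have hSm : MeasurableSet {x | 4 * m < f x ^ 2} := measurableSet_lt measurable_const hfm
  have hpt : ∀ x, ENNReal.ofReal (Φ (f x ^ 2)) ≤ ENNReal.ofReal (G x) +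
      {x | 4 * m < f x ^ 2}.indicator
        (fun x => ENNReal.ofReal (f x ^ 2 * (κ + φ (f x ^ 2 / m)))) x := by
    intro x
    rcases hG0 x with h | h
    · by_cases hx : f x ^ 2 ≤ 4 * m
      · exact le_add_right (ENNReal.ofReal_le_ofReal (hsmall x hx))
      · rw [indicator_of_mem (show x ∈ {x | 4 * m < f x ^ 2} from not_le.1 hx)]
        have hx0 : 0 < f x ^ 2 := by push Not at hx; linarith
        have hq : 0 < f x ^ 2 / m := by positivity
        have := hφpos _ hq.le
        rw [← ENNReal.ofReal_add (hGnn x) (by positivity), hΦφ _ hx0.le]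
        refine ENNReal.ofReal_le_ofReal ?_
        have hs := hsub _ _ hm hq
        rw [mul_div_cancel₀ _ hm.ne'] at hs
        nlinarith [mul_le_mul_of_nonneg_left hs hx0.le]
    · exact le_add_right (ENNReal.ofReal_le_ofReal (hsmall x h))
  have hLa : MemLp (fun x => |f x| - √m) 2 μ := hL.abs.sub (memLp_const _)
  have j1 : Integrable (fun x => f x ^ 2 * φ m) μ := hi2.mul_const _
  have j2 : Integrable (fun x => 9 * c * (|f x| - √m) ^ 2) μ := hLa.integrable_sq.const_mul _
  have j3 : Integrable (fun x => c * (f x ^ 2 - m)) μ :=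
    (hi2.sub (integrable_const _)).const_mul _
  have j4 : Integrable (fun x => f x ^ 2 * φ m + 9 * c * (|f x| - √m) ^ 2) μ := j1.add j2
  have hiG : Integrable G μ := j4.add j3
  have hintG : ∫ x, G x ∂μ ≤ Φ m + 18 * γ * variance f μ := by
    have e : ∫ x, G x ∂μ = m * φ m + 9 * c * ∫ x, (|f x| - √m) ^ 2 ∂μ := by
      simp only [hG]
      rw [integral_add j4 j3, integral_add j1 j2, integral_mul_const,
        integral_const_mul, integral_const_mul, integral_sub hi2 (integrable_const _), hmf]
      simp
    rw [e, hΦφ m hm.le]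
    have h1 := integral_abs_sub_sqrt_sq_le μ hL hm.le hmf
    have h2 := variance_nonneg f μ
    have h3 := mul_le_mul_of_nonneg_left h1 (by positivity : 0 ≤ 9 * c)
    nlinarith [mul_le_mul_of_nonneg_right hcγ h2]
  have hγ0 : 0 ≤ γ := hc0.trans hcγ
  rw [hmf]
  calc ∫⁻ x, ENNReal.ofReal (Φ (f x ^ 2)) ∂μ
      ≤ ∫⁻ x, (ENNReal.ofReal (G x) + {x | 4 * m < f x ^ 2}.indicator
        (fun x => ENNReal.ofReal (f x ^ 2 * (κ + φ (f x ^ 2 / m)))) x) ∂μ := lintegral_mono hpt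
    _ = ENNReal.ofReal (∫ x, G x ∂μ) + ∫⁻ x in {x | 4 * m < f x ^ 2},
          ENNReal.ofReal (f x ^ 2 * (κ + φ (f x ^ 2 / m))) ∂μ := by
        rw [lintegral_add_left' hiG.aemeasurable.ennreal_ofReal, lintegral_indicator hSm,
          ofReal_integral_eq_lintegral_ofReal hiG (Eventually.of_forall hGnn)]
    _ ≤ (ENNReal.ofReal (Φ m) + ENNReal.ofReal (18 * γ) * (ENNReal.ofReal CP * energy μ f)) +
          ENNReal.ofReal (24 * (1 + κ / φ 8)) * B * energy μ f := by
        refine add_le_add ?_ (setLIntegral_tail_le μ hmono hφ0 hκ hB hf hL hm hmf)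
        refine (ENNReal.ofReal_le_ofReal hintG).trans ?_
        rw [ENNReal.ofReal_add (hnn m) (mul_nonneg (by positivity) (variance_nonneg f μ)),
          ENNReal.ofReal_mul (by positivity), ofReal_variance hL]
        gcongr
        exact hP f hf hL
    _ = _ := by
        rw [ENNReal.ofReal_mul (by positivity : 0 ≤ 18 * γ)]
        ring

/-! ### From the Sobolev inequality back to capacity -/

theorem integrable_of_mem_Icc {n : ℕ} (μ : Measure (E n)) [IsProbabilityMeasure μ]
    {X : E n → ℝ} (hX : Continuous X) {a b : ℝ} (hab : ∀ x, X x ∈ Icc a b) {ψ : ℝ → ℝ}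
    (hψ : Continuous ψ) : Integrable (fun x => ψ (X x)) μ := by
  obtain ⟨K, hK⟩ := isCompact_Icc.exists_bound_of_continuousOn (s := Icc a b) hψ.continuousOn
  exact Integrable.of_bound (hψ.comp hX).aestronglyMeasurable K
    (Eventually.of_forall fun x => hK _ (hab x))

/-- Reading the additive inequality at functions close to the constant `√a` yields a Poincaré
inequality. -/
theorem variance_le_of_additiveSobolev {n : ℕ} (μ : Measure (E n)) [IsProbabilityMeasure μ]
    {Φ : ℝ → ℝ} (hΦc : Continuous Φ) (hnn : ∀ x, 0 ≤ Φ x) (hC2 : ContDiffOn ℝ 2 Φ (Ioi 0))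
    {a : ℝ} (ha : 0 < a) (hdd : 0 < deriv (deriv Φ) a) {C : ℝ} (hC : 0 ≤ C)
    (hS : AdditiveSobolev μ Φ (ENNReal.ofReal C)) {f : E n → ℝ} (hf : ContDiff ℝ ∞ f)
    (hf0 : ∀ x, 0 ≤ f x) (hf1 : ∀ x, f x ≤ 1) (he : energy μ f ≠ ⊤) :
    a * deriv (deriv Φ) a * variance f μ ≤ C * (energy μ f).toReal := by
  have hd1 : ContDiffOn ℝ 1 (deriv Φ) (Ioi 0) := hC2.deriv_of_isOpen isOpen_Ioi (by norm_num)
  have hd2 : ContDiffOn ℝ 0 (deriv (deriv Φ)) (Ioi 0) :=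
    hd1.deriv_of_isOpen isOpen_Ioi (by norm_num)
  have hcont : ContinuousAt (deriv (deriv Φ)) a :=
    hd2.continuousOn.continuousAt (Ioi_mem_nhds ha)
  -- Settling for half of `Φ''(a)` makes a fixed small `ε` suffice, so no limit `ε → 0` is needed.
  obtain ⟨q, hq⟩ : ∃ q, deriv (deriv Φ) a = 2 * q := ⟨deriv (deriv Φ) a / 2, by ring⟩
  have hq0 : 0 < q := by linarith
  have hev : ∀ᶠ x in nhds a, q < deriv (deriv Φ) x :=
    hcont.eventually (lt_mem_nhds (by linarith))
  obtain ⟨δ, hδ, hball⟩ := Metric.eventually_nhds_iff_ball.1 hev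
  obtain ⟨ε, hε, hεq⟩ : ∃ ε > 0, ∀ x ∈ Icc a (a + ε), q ≤ deriv (deriv Φ) x := by
    refine ⟨δ / 2, by positivity, fun x hx => (hball x ?_).le⟩
    rw [Metric.mem_ball, Real.dist_eq, abs_of_nonneg (by linarith [hx.1])]
    linarith [hx.2]
  -- Jensen for the convex `Φ - q x²/2` gives `∫ Φ(X) - Φ(∫ X) ≥ (q/2) Var X`. The Sobolev
  -- inequality for `√X` bounds the same difference from above.
  set ψ : ℝ → ℝ := fun x => Φ x - q / 2 * x ^ 2 with hψ
  have hψc : Continuous ψ := by fun_prop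
  have hpos : ∀ x ∈ interior (Icc a (a + ε)), 0 < x := fun x hx =>
    ha.trans_le (interior_subset hx).1
  have hΦd : ∀ x, 0 < x → DifferentiableAt ℝ Φ x := fun x hx =>
    (hC2.differentiableOn (by norm_num)).differentiableAt (Ioi_mem_nhds hx)
  have hΦdd : ∀ x, 0 < x → DifferentiableAt ℝ (deriv Φ) x := fun x hx =>
    (hd1.differentiableOn (by norm_num)).differentiableAt (Ioi_mem_nhds hx)
  have hψ1 : ∀ x, 0 < x → HasDerivAt ψ (deriv Φ x - q * x) x := by
    intro x hx
    have := (hΦd x hx).hasDerivAt.sub (((hasDerivAt_id x).pow 2).const_mul (q / 2))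
    refine this.congr_deriv ?_
    simp; ring
  have hψ2 : ∀ x, 0 < x → HasDerivAt (deriv ψ) (deriv (deriv Φ) x - q) x := by
    intro x hx
    have := (hΦdd x hx).hasDerivAt.sub ((hasDerivAt_id x).const_mul q)
    refine (this.congr_deriv (by simp)).congr_of_eventuallyEq ?_
    filter_upwards [Ioi_mem_nhds hx] with y hy
    simpa using (hψ1 y hy).deriv
  have hconv : ConvexOn ℝ (Icc a (a + ε)) ψ := by
    refine convexOn_of_deriv2_nonneg (convex_Icc _ _) hψc.continuousOn
      (fun x hx => (hψ1 x (hpos x hx)).differentiableAt.differentiableWithinAt)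
      (fun x hx => (hψ2 x (hpos x hx)).differentiableAt.differentiableWithinAt) fun x hx => ?_
    simp only [Function.iterate_succ, Function.iterate_zero, Function.comp, id]
    rw [(hψ2 x (hpos x hx)).deriv]
    linarith [hεq x (interior_subset hx)]
  set X : E n → ℝ := fun x => a + ε * f x with hX
  have hXc : Continuous X := by have := hf.continuous; fun_prop
  have hXm : ∀ x, X x ∈ Icc a (a + ε) := fun x =>
    ⟨by simp only [hX]; nlinarith [hf0 x], by simp only [hX]; nlinarith [hf1 x]⟩
  have hXpos : ∀ x, 0 < X x := fun x => ha.trans_le (hXm x).1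
  have iX : Integrable X μ := integrable_of_mem_Icc μ hXc hXm continuous_id
  have iX2 : Integrable (fun x => X x ^ 2) μ :=
    integrable_of_mem_Icc μ hXc hXm (ψ := fun x => x ^ 2) (by fun_prop)
  have iΦ : Integrable (fun x => Φ (X x)) μ := integrable_of_mem_Icc μ hXc hXm hΦc
  have hjen := hconv.map_integral_le hψc.continuousOn isClosed_Icc
    (Eventually.of_forall hXm) iX (integrable_of_mem_Icc μ hXc hXm hψc)
  have hint : ∫ x, ψ (X x) ∂μ = ∫ x, Φ (X x) ∂μ - q / 2 * ∫ x, X x ^ 2 ∂μ := by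
    simp only [hψ]
    rw [integral_sub iΦ (iX2.const_mul _), integral_const_mul]
  have hLX : MemLp X 2 μ := (memLp_two_iff_integrable_sq hXc.aestronglyMeasurable).2 iX2
  have hvar : variance X μ = ∫ x, X x ^ 2 ∂μ - (∫ x, X x ∂μ) ^ 2 := variance_eq_sub hLX
  have hvar' : variance X μ = ε ^ 2 * variance f μ := by
    rw [hX, variance_const_add (by have := hf.continuous; fun_prop), variance_const_mul]
  have hg : ContDiff ℝ ∞ fun x => √(X x) :=
    (contDiff_const.add (contDiff_const.mul hf)).sqrt fun x => (hXpos x).ne'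
  have hgsq : ∀ x, √(X x) ^ 2 = X x := fun x => Real.sq_sqrt (hXpos x).le
  have hLg : MemLp (fun x => √(X x)) 2 μ := by
    rw [memLp_two_iff_integrable_sq hg.continuous.aestronglyMeasurable]
    simpa only [hgsq] using iX
  have hgE : energy μ (fun x => √(X x)) ≤ ENNReal.ofReal (ε ^ 2 / (4 * a)) * energy μ f := by
    unfold energy
    rw [← lintegral_const_mul' _ _ ENNReal.ofReal_ne_top]
    refine lintegral_mono fun x => ?_
    have hder : HasDerivAt (fun s => √(a + ε * s)) (ε / (2 * √(X x))) (f x) := by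
      have h1 : HasDerivAt (fun s => a + ε * s) ε (f x) := by
        simpa using ((hasDerivAt_id (f x)).const_mul ε).const_add a
      exact h1.sqrt (hXpos x).ne'
    rw [enorm_gradient_comp hder (hf.differentiable (by simp) x), mul_pow, enorm_sq_eq_ofReal]
    gcongr
    rw [div_pow, mul_pow, hgsq]
    norm_num
    gcongr
    exact (hXm x).1
  have key := hS _ hg hLg
  simp only [hgsq] at key
  rw [← ofReal_integral_eq_lintegral_ofReal iΦ (Eventually.of_forall fun x => hnn _)] at key
  have key2 : ENNReal.ofReal (∫ x, Φ (X x) ∂μ) ≤ ENNReal.ofReal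
      (Φ (∫ x, X x ∂μ) + C * (ε ^ 2 / (4 * a) * (energy μ f).toReal)) := by
    rw [ENNReal.ofReal_add (hnn _) (by positivity), ENNReal.ofReal_mul hC,
      ENNReal.ofReal_mul (by positivity), ENNReal.ofReal_toReal he]
    exact key.trans (by gcongr)
  rw [ENNReal.ofReal_le_ofReal_iff (add_nonneg (hnn _) (by positivity))] at key2
  rw [hint] at hjen
  simp only [hψ] at hjen
  have h3 : q / 2 * (ε ^ 2 * variance f μ) ≤ C * (ε ^ 2 / (4 * a) * (energy μ f).toReal) := by
    rw [← hvar', hvar]; linarith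
  rw [hq]
  have e1 : q / 2 * (ε ^ 2 * variance f μ) = ε ^ 2 / (4 * a) * (a * (2 * q) * variance f μ) := by
    field_simp; ring
  have e2 : C * (ε ^ 2 / (4 * a) * (energy μ f).toReal)
      = ε ^ 2 / (4 * a) * (C * (energy μ f).toReal) := by ring
  rw [e1, e2] at h3
  exact le_of_mul_le_mul_left h3 (by positivity)

/-- Cauchy–Schwarz on `{f ≠ 0}`, of mass at most `1/2`, gives `(∫ f)² ≤ (1/2) ∫ f²`; the proof
expands `(f - t)² ≥ 0` there with the optimal `t = 2 ∫ f`. -/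
theorem integral_sq_le_two_mul_variance {n : ℕ} (μ : Measure (E n)) [IsProbabilityMeasure μ]
    {f : E n → ℝ} (hf : Continuous f) (hL : MemLp f 2 μ) (hZ : 1 / 2 ≤ μ {x | f x = 0}) :
    ∫ x, f x ^ 2 ∂μ ≤ 2 * variance f μ := by
  have i1 : Integrable f μ := hL.integrable (by norm_num)
  have hZm : MeasurableSet {x | f x = 0} := measurableSet_eq_fun hf.measurable measurable_const
  have hZr : μ.real {x | f x = 0}ᶜ ≤ 1 / 2 := by
    have : (1 / 2 : ℝ) ≤ μ.real {x | f x = 0} := by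
      have := ENNReal.toReal_mono (measure_ne_top _ _) hZ
      simpa [measureReal_def] using this
    rw [probReal_compl_eq_one_sub hZm]; linarith
  set t := 2 * ∫ x, f x ∂μ with ht
  have iZ : Integrable ({x | f x = 0}ᶜ.indicator fun _ => t ^ 2) μ :=
    (integrable_const _).indicator hZm.compl
  have hpt : ∀ x, 0 ≤ f x ^ 2 - 2 * t * f x + {x | f x = 0}ᶜ.indicator (fun _ => t ^ 2) x := by
    intro x
    by_cases hx : f x = 0
    · rw [indicator_of_notMem (by simpa using hx)]; simp [hx]
    · rw [indicator_of_mem (by simpa using hx)]; nlinarith [sq_nonneg (f x - t)]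
  have h := integral_nonneg_of_ae (μ := μ) (Eventually.of_forall hpt)
  have j1 : Integrable (fun x => 2 * t * f x) μ := i1.const_mul _
  have j2 : Integrable (fun x => f x ^ 2 - 2 * t * f x) μ := hL.integrable_sq.sub j1
  rw [integral_add j2 iZ, integral_sub hL.integrable_sq j1, integral_const_mul,
    integral_indicator_const _ hZm.compl, smul_eq_mul] at h
  have hv : variance f μ = ∫ x, f x ^ 2 ∂μ - (∫ x, f x ∂μ) ^ 2 := variance_eq_sub hL
  rw [hv]
  nlinarith [mul_le_mul_of_nonneg_right hZr (sq_nonneg t)]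

/-- The `λ`-condition says that `x / φ x` almost inverts `s ↦ s φ s`. With `x = max (2y) (2λ)`,
either `x / φ x ≤ s`, and then `φ x ≤ λ φ s`, or `s φ x ≤ x ≤ λ y`. -/
theorem mul_le_of_mul_self_le {φ : ℝ → ℝ} (hmono : MonotoneOn φ (Ici 0)) (hφ0 : 0 < φ 0)
    {lam : ℝ} (hlam : 2 ≤ lam) (hlam' : ∀ x, 2 * lam ≤ x → φ x ≤ lam * φ (x / φ x))
    {s y : ℝ} (hs : 0 < s) (hy : 2 ≤ y) (h : s * φ s ≤ y) : s * φ (2 * y) ≤ lam * y := by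
  have hφpos : ∀ x, 0 ≤ x → 0 < φ x := fun x hx => hφ0.trans_le (hmono self_mem_Ici hx hx)
  set x := max (2 * y) (2 * lam) with hx
  have hx0 : 0 ≤ x := by have := le_max_left (2 * y) (2 * lam); linarith
  have hφx := hφpos x hx0
  have h1 : φ (2 * y) ≤ φ x :=
    hmono (by simp only [mem_Ici]; linarith) hx0 (le_max_left _ _)
  rcases le_total (x / φ x) s with hxs | hxs
  · have h2 : φ x ≤ lam * φ s := (hlam' x (le_max_right _ _)).trans
      (mul_le_mul_of_nonneg_left (hmono (by simp only [mem_Ici]; positivity) hs.le hxs)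
        (by linarith))
    calc s * φ (2 * y) ≤ s * (lam * φ s) := by gcongr; exact h1.trans h2
      _ = lam * (s * φ s) := by ring
      _ ≤ lam * y := by gcongr
  · rw [le_div_iff₀ hφx] at hxs
    calc s * φ (2 * y) ≤ s * φ x := by gcongr
      _ ≤ x := hxs
      _ ≤ lam * y := max_le (by nlinarith) (by nlinarith)

theorem measure_mul_le_energy {n : ℕ} (μ : Measure (E n)) [IsProbabilityMeasure μ]
    {Φ φ : ℝ → ℝ} (hΦc : Continuous Φ) (hnn : ∀ x, 0 ≤ Φ x) (hC2 : ContDiffOn ℝ 2 Φ (Ioi 0))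
    (hΦφ : ∀ x, 0 ≤ x → Φ x = x * φ x) (hmono : MonotoneOn φ (Ici 0)) (hφ0 : 0 < φ 0)
    {k₀ : ℝ} (hk₀ : 0 < k₀) (hΦk : Φ k₀ ≤ 1) {lam : ℝ} (hlam : 2 ≤ lam)
    (hlam' : ∀ x, 2 * lam ≤ x → φ x ≤ lam * φ (x / φ x))
    {a : ℝ} (ha : 0 < a) (hdd : 0 < deriv (deriv Φ) a) {C : ℝ} (hC : 0 < C)
    (hS : AdditiveSobolev μ Φ (ENNReal.ofReal C)) {A : Set (E n)}
    (hAh : μ A < 1 / 2) {f : E n → ℝ} (hf : ContDiff ℝ ∞ f)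
    (hAf : ∀ x, A.indicator 1 x ≤ f x) (hf1 : ∀ x, f x ≤ 1) (hZ : 1 / 2 ≤ μ {x | f x = 0}) :
    ENNReal.ofReal (μ.real A * φ (2 / μ.real A)) ≤ ENNReal.ofReal
      (16 * lam / k₀ * (1 / (2 * a * deriv (deriv Φ) a) + 1 / φ 0) * C) * energy μ f := by
  have hf0 : ∀ x, 0 ≤ f x := fun x =>
    (indicator_nonneg (fun _ _ => zero_le_one) x).trans (hAf x)
  have hfA : ∀ x ∈ A, f x = 1 := fun x hx => le_antisymm (hf1 x) (by
    have := hAf x; rwa [indicator_of_mem hx] at this)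
  set D := 2 * a * deriv (deriv Φ) a with hD
  have hD0 : 0 < D := by positivity
  rcases eq_or_ne (energy μ f) ⊤ with he | he
  · rw [he, ENNReal.mul_top]
    · exact le_top
    · rw [Ne, ENNReal.ofReal_eq_zero, not_le]; positivity
  obtain ⟨e, hee⟩ : ∃ e, (energy μ f).toReal = e := ⟨_, rfl⟩
  have he0 : 0 ≤ e := hee ▸ ENNReal.toReal_nonneg
  have hE : energy μ f = ENNReal.ofReal e := by rw [← hee, ENNReal.ofReal_toReal he]
  rw [hE, ← ENNReal.ofReal_mul (by positivity)]
  refine ENNReal.ofReal_le_ofReal ?_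
  have hIcc : ∀ x, f x ∈ Icc (0 : ℝ) 1 := fun x => ⟨hf0 x, hf1 x⟩
  have i2 : Integrable (fun x => f x ^ 2) μ :=
    integrable_of_mem_Icc μ hf.continuous hIcc (ψ := fun x => x ^ 2) (by fun_prop)
  have hL : MemLp f 2 μ :=
    (memLp_two_iff_integrable_sq hf.continuous.aestronglyMeasurable).2 i2
  obtain ⟨m, hm⟩ : ∃ m, ∫ x, f x ^ 2 ∂μ = m := ⟨_, rfl⟩
  have hm0 : 0 ≤ m := hm ▸ integral_nonneg fun x => sq_nonneg _
  have hPo := variance_le_of_additiveSobolev μ hΦc hnn hC2 ha hdd hC.le hS hf hf0 hf1 he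
  rw [hee] at hPo
  have hmv := integral_sq_le_two_mul_variance μ hf.continuous hL hZ
  rw [hm] at hmv
  have hmD : D * m ≤ 4 * (C * e) := by
    have := mul_le_mul_of_nonneg_left hmv hD0.le
    rw [hD] at this ⊢
    linarith
  have hsob : ∀ s, 0 ≤ s → Φ s * μ.real A ≤ Φ (s * m) + C * (s * e) := by
    intro s hs
    have hsf : ∀ x, (√s * f x) ^ 2 = s * f x ^ 2 := fun x => by rw [mul_pow, Real.sq_sqrt hs]
    have h := hS (fun x => √s * f x) (contDiff_const.mul hf) (hL.const_mul _)
    rw [energy_const_mul μ (hf.differentiable (by simp)), Real.sq_sqrt hs, hE] at h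
    simp only [hsf] at h
    rw [integral_const_mul, hm, ← ENNReal.ofReal_mul hs, ← ENNReal.ofReal_mul hC.le,
      ← ENNReal.ofReal_add (hnn _) (by positivity)] at h
    have hiΦ : Integrable (fun x => Φ (s * f x ^ 2)) μ :=
      integrable_of_mem_Icc μ hf.continuous hIcc (ψ := fun r => Φ (s * r ^ 2)) (by fun_prop)
    have hlow : ENNReal.ofReal (Φ s * μ.real A) ≤ ∫⁻ x, ENNReal.ofReal (Φ (s * f x ^ 2)) ∂μ := by
      rw [ENNReal.ofReal_mul (hnn s), ofReal_measureReal (measure_ne_top _ _)]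
      refine (mul_le_mul_right (measure_mono ?_) _).trans (mul_meas_ge_le_lintegral
        (hΦc.comp (by have := hf.continuous; fun_prop)).measurable.ennreal_ofReal _)
      intro x hx
      simp [hfA x hx]
    exact (ENNReal.ofReal_le_ofReal_iff (add_nonneg (hnn _) (by positivity))).1 (hlow.trans h)
  rcases (measureReal_nonneg (μ := μ) (s := A)).eq_or_lt with hM | hM
  · rw [← hM, zero_mul]; positivity
  set M := μ.real A with hMdef
  have hMle : M ≤ 1 / 2 := by
    have := ENNReal.toReal_mono (by simp) hAh.le
    simpa [hMdef, measureReal_def] using this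
  have hMm : M ≤ m := by
    have h := mul_meas_ge_le_integral_of_nonneg (μ := μ) (f := fun x => f x ^ 2)
      (Eventually.of_forall fun x => sq_nonneg _) i2 1
    rw [one_mul, hm] at h
    refine (measureReal_mono ?_).trans h
    intro x hx
    simp [hfA x hx]
  -- Zero energy would force `m = 0`, contradicting `m ≥ μ(A) > 0`.
  have he1 : 0 < e := by
    rcases he0.eq_or_lt with h | h
    · rw [← h] at hmD
      nlinarith
    · exact h
  set α := 1 / D with hα
  set β := 1 / φ 0 with hβ
  have hα0 : 0 < α := by positivity
  have hβ0 : 0 < β := by positivity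
  have hmα : m ≤ 4 * α * (C * e) := by
    rw [hα, mul_one_div, div_mul_eq_mul_div, le_div_iff₀ hD0]; linarith
  have hk0 : k₀ * φ k₀ ≤ 1 := by rwa [← hΦφ k₀ hk₀.le]
  have hkβ : k₀ ≤ β := by
    rw [hβ, le_div_iff₀ hφ0]
    exact (mul_le_mul_of_nonneg_left (hmono self_mem_Ici hk₀.le hk₀.le) hk₀.le).trans hk0
  -- This `s` splits the budget `1`: `Φ(sm)` takes at most `α/(α+β)`, by `k₀ φ(k₀) ≤ 1`, and the
  -- energy term at most `β/(α+β)`, by `k₀ ≤ β`.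
  obtain ⟨s, hs⟩ : ∃ s, s = k₀ / (4 * ((α + β) * (C * e))) := ⟨_, rfl⟩
  have hs0 : 0 < s := by rw [hs]; positivity
  have hsCe : s * (C * e) = k₀ / (4 * (α + β)) := by rw [hs]; field_simp
  have hsm : s * m ≤ k₀ * (α / (α + β)) := by
    calc s * m ≤ s * (4 * α * (C * e)) := by gcongr
      _ = 4 * α * (s * (C * e)) := by ring
      _ = k₀ * (α / (α + β)) := by rw [hsCe]; field_simp
  have hfrac : α / (α + β) ≤ 1 := by rw [div_le_one (by positivity)]; linarith
  have hsmk : s * m ≤ k₀ := hsm.trans (mul_le_of_le_one_right hk₀.le hfrac)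
  have hφk : 0 < φ k₀ := hφ0.trans_le (hmono self_mem_Ici hk₀.le hk₀.le)
  have hΦsm : Φ (s * m) ≤ α / (α + β) := by
    have hsm0 : 0 ≤ s * m := by positivity
    rw [hΦφ _ hsm0]
    calc s * m * φ (s * m) ≤ k₀ * (α / (α + β)) * φ k₀ :=
          mul_le_mul hsm (hmono hsm0 hk₀.le hsmk)
            (hφ0.trans_le (hmono self_mem_Ici hsm0 hsm0)).le (by positivity)
      _ = α / (α + β) * (k₀ * φ k₀) := by ring
      _ ≤ α / (α + β) := mul_le_of_le_one_right (by positivity) hk0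
  have hΦs : s * φ s * M ≤ 1 := by
    have h1 := hsob s hs0.le
    rw [hΦφ s hs0.le] at h1
    have h2 : C * (s * e) ≤ β / (α + β) := by
      rw [show C * (s * e) = s * (C * e) by ring, hsCe, div_le_div_iff₀ (by positivity)
        (by positivity)]
      nlinarith
    have h3 : α / (α + β) + β / (α + β) = 1 := by rw [← add_div, div_self (by positivity)]
    linarith
  have hfin := mul_le_of_mul_self_le hmono hφ0 hlam hlam' hs0 (y := 1 / M)
    (by rw [le_div_iff₀ hM]; linarith) (by rwa [le_div_iff₀ hM])
  have h4 : M * φ (2 / M) ≤ lam / s := by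
    rw [mul_one_div, mul_one_div, le_div_iff₀ hM] at hfin
    rw [le_div_iff₀ hs0]
    linarith
  have h5 : lam / s = 4 * lam / k₀ * (α + β) * C * e := by
    rw [hs]; field_simp
  -- The argument yields `4λ/k₀`; a factor `4` is given away to match the stated constant.
  have h6 : 0 ≤ 4 * lam / k₀ * (α + β) * C * e := by positivity
  calc M * φ (2 / M) ≤ 4 * lam / k₀ * (α + β) * C * e := h5 ▸ h4
    _ ≤ 4 * (4 * lam / k₀ * (α + β) * C * e) := by linarith
    _ = 16 * lam / k₀ * (α + β) * C * e := by ring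

/-! ### Passage to the optimal constants -/

theorem additiveSobolev_mono {n : ℕ} {μ : Measure (E n)} {Φ : ℝ → ℝ} {C C' : ℝ≥0∞}
    (h : C ≤ C') (hS : AdditiveSobolev μ Φ C) : AdditiveSobolev μ Φ C' :=
  fun f hf hL => (hS f hf hL).trans (by gcongr)

theorem ofReal_mul_capacityConst_le {n : ℕ} (μ : Measure (E n)) [IsProbabilityMeasure μ]
    {Φ φ : ℝ → ℝ} (hΦc : Continuous Φ) (hnn : ∀ x, 0 ≤ Φ x) (hC2 : ContDiffOn ℝ 2 Φ (Ioi 0))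
    (hΦφ : ∀ x, 0 ≤ x → Φ x = x * φ x) (hmono : MonotoneOn φ (Ici 0)) (hφ0 : 0 < φ 0)
    {k₀ : ℝ} (hk₀ : 0 < k₀) (hΦk : Φ k₀ ≤ 1) {lam : ℝ} (hlam : 2 ≤ lam)
    (hlam' : ∀ x, 2 * lam ≤ x → φ x ≤ lam * φ (x / φ x)) {a : ℝ} (ha : 0 < a)
    (hdd0 : 0 ≤ deriv (deriv Φ) a) :
    ENNReal.ofReal (k₀ * a * deriv (deriv Φ) a * φ 0 /
        (8 * lam * (φ 0 + 2 * a * deriv (deriv Φ) a))) * capacityConst μ φ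
      ≤ sobolevConst μ Φ := by
  rcases hdd0.eq_or_lt with hdd | hdd
  · rw [← hdd]; simp
  refine le_sInf fun C hC => ?_
  rcases eq_or_ne C ⊤ with hCt | hCt
  · rw [hCt]; exact le_top
  -- The choice of `s` divides by the Sobolev constant, so `C` is enlarged by `ε` to make it
  -- positive.
  refine ENNReal.le_of_forall_pos_le_add fun ε hε _ => ?_
  obtain ⟨c, hc⟩ : ∃ c : ℝ, (C + ε).toReal = c := ⟨_, rfl⟩
  have hne : C + ε ≠ ⊤ := ENNReal.add_ne_top.2 ⟨hCt, ENNReal.coe_ne_top⟩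
  have hc0 : 0 < c := by
    rw [← hc]
    exact ENNReal.toReal_pos (by simpa using fun _ => hε.ne') hne
  have hcC : C + ε = ENNReal.ofReal c := by rw [← hc, ENNReal.ofReal_toReal hne]
  have hS : AdditiveSobolev μ Φ (ENNReal.ofReal c) :=
    additiveSobolev_mono (hcC ▸ le_self_add) hC
  have hlam0 : 0 < lam := by linarith
  have hB : capacityConst μ φ ≤ ENNReal.ofReal
      (16 * lam / k₀ * (1 / (2 * a * deriv (deriv Φ) a) + 1 / φ 0) * c) := by
    refine sInf_le fun A _ hA => ?_
    have hK : ENNReal.ofReal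
        (16 * lam / k₀ * (1 / (2 * a * deriv (deriv Φ) a) + 1 / φ 0) * c) ≠ 0 := by
      rw [Ne, ENNReal.ofReal_eq_zero, not_le]; positivity
    rw [← ENNReal.div_le_iff' hK ENNReal.ofReal_ne_top]
    refine le_sInf ?_
    rintro _ ⟨f, ⟨hf, hAf, hf1, hZ⟩, rfl⟩
    rw [ENNReal.div_le_iff' hK ENNReal.ofReal_ne_top]
    exact measure_mul_le_energy μ hΦc hnn hC2 hΦφ hmono hφ0 hk₀ hΦk hlam hlam' ha hdd hc0 hS hA
      hf hAf hf1 hZ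
  rw [hcC]
  refine (mul_le_mul_right hB _).trans (le_of_eq ?_)
  rw [← ENNReal.ofReal_mul (by positivity)]
  congr 1
  field_simp
  ring

theorem sobolevConst_le {n : ℕ} (μ : Measure (E n)) [IsProbabilityMeasure μ]
    {Φ φ : ℝ → ℝ} (hnn : ∀ x, 0 ≤ Φ x) (hΦφ : ∀ x, 0 ≤ x → Φ x = x * φ x)
    (hmono : MonotoneOn φ (Ici 0)) (hconc : ConcaveOn ℝ (Ici 0) φ)
    (hφd : ∀ x, 0 < x → DifferentiableAt ℝ φ x)
    (hφ0 : 0 < φ 0) {γ κ : ℝ} (hκ : 0 ≤ κ) (hγ : ∀ x, 0 < x → x * deriv φ x ≤ γ)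
    (hsub : ∀ x y, 0 < x → 0 < y → φ (x * y) ≤ κ + φ x + φ y)
    {CP : ℝ} (hP : Poincare μ (ENNReal.ofReal CP)) :
    sobolevConst μ Φ ≤ ENNReal.ofReal (18 * γ * CP) +
      ENNReal.ofReal (24 * (1 + κ / φ 8)) * capacityConst μ φ := by
  have h8 : 0 < φ 8 := hφ0.trans_le (hmono self_mem_Ici
    (by norm_num : (8 : ℝ) ∈ Ici 0) (by norm_num))
  -- A nonzero finite factor commutes with the infimum defining `capacityConst`, even when that
  -- infimum is not known to be attained.
  have hK : ENNReal.ofReal (24 * (1 + κ / φ 8)) ≠ 0 := by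
    rw [Ne, ENNReal.ofReal_eq_zero, not_le]; positivity
  rw [capacityConst, sInf_eq_iInf', ENNReal.mul_iInf_of_ne hK ENNReal.ofReal_ne_top,
    ENNReal.add_iInf]
  exact le_iInf fun B => sInf_le
    (additiveSobolev_of_capacity μ hnn hΦφ hmono hconc hφd hφ0 hκ hγ hsub hP B.2)

end PhiSobolev

theorem mainTheorem9 (n : ℕ) (μ : Measure (PhiSobolev.E n)) [IsProbabilityMeasure μ]
    (Φ φ : ℝ → ℝ)
    (hYoung : PhiSobolev.IsYoung Φ) (hC2 : ContDiffOn ℝ 2 Φ (Ioi 0))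
    (hΦφ : ∀ x, 0 ≤ x → Φ x = x * φ x)
    (hmono : MonotoneOn φ (Ici 0)) (hconc : ConcaveOn ℝ (Ici 0) φ)
    (hφ0 : 0 < φ 0) (hlim : Tendsto φ atTop atTop)
    (k₀ : ℝ) (hk₀ : 0 < k₀) (hk₀' : k₀ * deriv Φ k₀ = 1)
    (γ κ lam : ℝ) (hκ : 0 ≤ κ)
    (hγ : ∀ x, 0 < x → x * deriv φ x ≤ γ)
    (hsub : ∀ x y, 0 < x → 0 < y → φ (x * y) ≤ κ + φ x + φ y)
    (hlam : 2 ≤ lam) (hlam' : ∀ x, 2 * lam ≤ x → φ x ≤ lam * φ (x / φ x))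
    (CP : ℝ) (hCP : 0 ≤ CP) (hP : PhiSobolev.Poincare μ (ENNReal.ofReal CP)) :
    (∀ a : ℝ, 0 < a →
      ENNReal.ofReal (k₀ * a * deriv (deriv Φ) a * φ 0 /
          (8 * lam * (φ 0 + 2 * a * deriv (deriv Φ) a))) * PhiSobolev.capacityConst μ φ
        ≤ PhiSobolev.sobolevConst μ Φ) ∧
    PhiSobolev.sobolevConst μ Φ
      ≤ ENNReal.ofReal (18 * γ * CP) +
        ENNReal.ofReal (24 * (1 + κ / φ 8)) * PhiSobolev.capacityConst μ φ := by
  have hΦd : ∀ x, 0 < x → DifferentiableAt ℝ Φ x := fun x hx =>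
    (hC2.differentiableOn (by norm_num)).differentiableAt (Ioi_mem_nhds hx)
  constructor
  · intro a ha
    have hΦc : Continuous Φ := continuousOn_univ.1 (hYoung.convex.continuousOn isOpen_univ)
    -- Convexity and `Φ 0 = 0` give `Φ(k₀) ≤ k₀ Φ'(k₀) = 1`.
    have hΦk : Φ k₀ ≤ 1 := by
      have h := hYoung.convex.slope_le_deriv (mem_univ 0) (mem_univ k₀) hk₀ (hΦd k₀ hk₀)
      rw [slope_def_field, hYoung.zero, sub_zero, sub_zero, div_le_iff₀ hk₀] at h
      linarith
    have hdd : 0 ≤ deriv (deriv Φ) a := by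
      have hm : MonotoneOn (deriv Φ) (Ioi 0) :=
        (hYoung.convex.subset (subset_univ _) (convex_Ioi 0)).monotoneOn_deriv hΦd
      rw [← derivWithin_of_isOpen isOpen_Ioi ha]
      exact hm.derivWithin_nonneg
    exact PhiSobolev.ofReal_mul_capacityConst_le μ hΦc hYoung.nonneg hC2 hΦφ hmono hφ0 hk₀ hΦk
      hlam hlam' ha hdd
  · have hφd : ∀ x, 0 < x → DifferentiableAt ℝ φ x := by
      intro x hx
      refine ((hΦd x hx).div differentiableAt_id hx.ne').congr_of_eventuallyEq ?_
      filter_upwards [Ioi_mem_nhds hx] with y (hy : 0 < y)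
      simp [hΦφ y hy.le, hy.ne']
    exact PhiSobolev.sobolevConst_le μ hYoung.nonneg hΦφ hmono hconc hφd hφ0 hκ hγ hsub hP
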